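/- Let $M=\Gamma\backslash\mathbb H^3$ be a closed oriented hyperbolic 3-manifold, where $\Gamma\le \mathrm{Isom}^+(\mathbb H^3)$ acts freely and properly discontinuously with compact quotient. Let $\epsilon,R>0$, and let $V\subset M$ be an embedded tube of depth $R$ about a closed geodesic $C$ of length $\epsilon$. That is: $c:\mathbb R\to\mathbb H^3$ is a geodesic line parametrized by arc length; $\gamma\in\Gamma$ satisfies $\gamma(c(s))=c(s+\epsilon)$ for all $s$; $N$ is the open $R$-neighbourhood of $c(\mathbb R)$ in $\mathbb H^3$; the natural map $\langle\gamma\rangle\backslash N\to M$ is injective; $V$ is its image; and $C=\langle\gamma\rangle\backslash c(\mathbb R)$, oriented by $c$. Let $\alpha$ be a harmonic 1-form on $M$, i.e. a smooth closed 1-form whose $L^2$-norm is minimal in its de Rham cohomology class. If $\int_C\alpha=1$, then $$\|\alpha|_V\|_{L^2}=\Big(\int_V|\alpha|^2\,d\mathrm{Vol}\Big)^{1/2}\;\ge\;\sqrt{\frac{2\pi}{\epsilon}\,\log(\cosh R)} .$$ -/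

import Mathlib

namespace HypTube

open MeasureTheory

/-- Hyperbolic 3-space in the upper half-space model: pairs `(x, t)` with `x : ℂ`, `t > 0`, carrying
the Riemannian metric `(|dx|² + dt²) / t²`. -/
abbrev H3 : Type := {p : ℂ × ℝ // 0 < p.2}

/-- The upper half-space as an open subset of `ℂ × ℝ`. -/
def upper : Set (ℂ × ℝ) := {p | 0 < p.2}

/-- The hyperbolic distance: `cosh d(p, q) = 1 + |p - q|² / (2 t_p t_q)`, where `|p - q|` is the
Euclidean distance. -/
noncomputable def hdist (p q : H3) : ℝ :=
  Real.arcosh (1 + (‖p.1.1 - q.1.1‖ ^ 2 + (p.1.2 - q.1.2) ^ 2) / (2 * p.1.2 * q.1.2))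

/-- The hyperbolic volume `dx dt / t³`. -/
noncomputable def hvol : Measure H3 :=
  (Measure.comap Subtype.val (volume : Measure (ℂ × ℝ))).withDensity
    (fun p => ENNReal.ofReal (1 / p.1.2 ^ 3))

/-- A self-map of hyperbolic space seen as a map on `ℂ × ℝ` (only its values on the upper half-space
matter), so that it can be differentiated. -/
noncomputable def extend (φ : H3 → H3) : ℂ × ℝ → ℂ × ℝ :=
  open Classical in fun q => if h : 0 < q.2 then (φ ⟨q, h⟩).1 else q

/-- Elements of `Isom⁺(ℍ³)`: bijections that preserve the distance and the orientation.
(Isometries of hyperbolic space are automatically smooth.) -/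
structure IsOrientedIsometry (φ : Equiv.Perm H3) : Prop where
  hdist_eq : ∀ p q : H3, hdist (φ p) (φ q) = hdist p q
  smooth : ContDiffOn ℝ (⊤ : ℕ∞) (extend φ) upper
  orientation : ∀ p : H3, 0 < (fderiv ℝ (extend φ) p.1).det

/-- The quotient `M = Γ \ ℍ³`. -/
abbrev Quot3 (Γ : Subgroup (Equiv.Perm H3)) : Type := Quotient (MulAction.orbitRel Γ H3)

/-- The universal covering map `ℍ³ → Γ \ ℍ³`. -/
def proj (Γ : Subgroup (Equiv.Perm H3)) (p : H3) : Quot3 Γ := Quotient.mk _ p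

/-- `Γ ≤ Isom⁺(ℍ³)` acts freely and properly discontinuously with compact quotient, i.e. `Γ \ ℍ³` is
a closed (oriented) hyperbolic 3-manifold. -/
structure IsClosedHyperbolic (Γ : Subgroup (Equiv.Perm H3)) : Prop where
  isometry : ∀ φ ∈ Γ, IsOrientedIsometry φ
  free : ∀ φ ∈ Γ, ∀ p : H3, φ p = p → φ = 1
  properlyDiscontinuous : ProperlyDiscontinuousSMul Γ H3
  compact : CompactSpace (Quot3 Γ)

/-- Smooth functions on `Γ \ ℍ³`, as `Γ`-invariant smooth functions on `ℍ³`. -/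
structure IsSmoothFunction (Γ : Subgroup (Equiv.Perm H3)) (f : ℂ × ℝ → ℝ) : Prop where
  smooth : ContDiffOn ℝ (⊤ : ℕ∞) f upper
  invariant : ∀ φ ∈ Γ, ∀ p : H3, f (φ p).1 = f p.1

/-- Smooth 1-forms on `Γ \ ℍ³`, as smooth 1-forms on `ℍ³` with `φ^* α = α` for all `φ ∈ Γ`. -/
structure IsOneForm (Γ : Subgroup (Equiv.Perm H3)) (α : ℂ × ℝ → (ℂ × ℝ →L[ℝ] ℝ)) : Prop where
  smooth : ContDiffOn ℝ (⊤ : ℕ∞) α upper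
  invariant : ∀ φ ∈ Γ, ∀ p : H3, (α (φ p).1).comp (fderiv ℝ (extend φ) p.1) = α p.1

/-- `dα = 0`, where `dα (u, v) = D_u α (v) - D_v α (u)`. -/
def IsClosedForm (α : ℂ × ℝ → (ℂ × ℝ →L[ℝ] ℝ)) : Prop :=
  ∀ p ∈ upper, ∀ u v : ℂ × ℝ, fderiv ℝ α p u v - fderiv ℝ α p v u = 0

/-- The squared pointwise norm `|α_p|²` for the hyperbolic metric: the sum of the squares of the
values on the orthonormal basis `t ∂_x, t ∂_y, t ∂_t` of the tangent space. -/
noncomputable def normSqAt (α : ℂ × ℝ → (ℂ × ℝ →L[ℝ] ℝ)) (p : H3) : ℝ :=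
  (p.1.2 * α p.1 (1, 0)) ^ 2 + (p.1.2 * α p.1 (Complex.I, 0)) ^ 2 + (p.1.2 * α p.1 (0, 1)) ^ 2

/-- The `L²`-norm over `W ⊆ Γ \ ℍ³` of a 1-form `α` on `Γ \ ℍ³`, i.e. `(∫_W |α|² dVol)^(1/2)`, the
integral being computed in a fundamental domain `D` of `Γ` (and independent of its choice). -/
noncomputable def l2NormOn (Γ : Subgroup (Equiv.Perm H3)) (D : Set H3) (W : Set (Quot3 Γ))
    (α : ℂ × ℝ → (ℂ × ℝ →L[ℝ] ℝ)) : ℝ :=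
  Real.sqrt (∫ p in D ∩ proj Γ ⁻¹' W, normSqAt α p ∂hvol)

/-- A harmonic 1-form on the closed manifold `Γ \ ℍ³`: a closed 1-form whose `L²`-norm is
minimal among all representatives `α + df` of its de Rham class. -/
structure IsHarmonic (Γ : Subgroup (Equiv.Perm H3)) (D : Set H3)
    (α : ℂ × ℝ → (ℂ × ℝ →L[ℝ] ℝ)) : Prop where
  isOneForm : IsOneForm Γ α
  closed : IsClosedForm α
  minimal : ∀ f : ℂ × ℝ → ℝ, IsSmoothFunction Γ f →
    l2NormOn Γ D Set.univ α ≤ l2NormOn Γ D Set.univ (fun p => α p + fderiv ℝ f p)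

/-- A geodesic line in `ℍ³` parametrized by arc length. -/
def IsGeodesicLine (c : ℝ → H3) : Prop := ∀ s t : ℝ, hdist (c s) (c t) = |s - t|

/-- The open `R`-neighbourhood in `ℍ³` of the line `c`. -/
def nbhd (c : ℝ → H3) (R : ℝ) : Set H3 := {p | ∃ s : ℝ, hdist p (c s) < R}

/-- `C = c(ℝ) / ⟨γ⟩` is a closed geodesic of length `ε` in `Γ \ ℍ³`, and it is the core of an
embedded tube of depth `R`: `γ ∈ Γ` translates the geodesic line `c` by `ε`, and the natural map
from the solid torus `⟨γ⟩ \ nbhd c R` to `Γ \ ℍ³` is injective. -/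
structure IsTube (Γ : Subgroup (Equiv.Perm H3)) (γ : Equiv.Perm H3) (c : ℝ → H3) (ε R : ℝ) :
    Prop where
  length_pos : 0 < ε
  depth_pos : 0 < R
  geodesic : IsGeodesicLine c
  mem : γ ∈ Γ
  translates : ∀ s : ℝ, γ (c s) = c (s + ε)
  embedded : ∀ p ∈ nbhd c R, ∀ q ∈ nbhd c R, proj Γ p = proj Γ q → ∃ n : ℤ, q = (γ ^ n) p

/-- The tube `V ⊆ Γ \ ℍ³` of depth `R` about the image of the line `c`. -/
def tube (Γ : Subgroup (Equiv.Perm H3)) (c : ℝ → H3) (R : ℝ) : Set (Quot3 Γ) :=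
  proj Γ '' nbhd c R

/-- The integral of `α` over the closed geodesic of length `ε` covered by the line `c`. -/
noncomputable def coreIntegral (c : ℝ → H3) (ε : ℝ) (α : ℂ × ℝ → (ℂ × ℝ →L[ℝ] ℝ)) : ℝ :=
  ∫ s in (0 : ℝ)..ε, α (c s).1 (deriv (fun u => (c u).1) s)

end HypTube

namespace HypTube

open MeasureTheory Topology Filter

/-! A closed form lifts to `df` on the contractible upper half-space, and invariance together with
the core integral gives `f ∘ γ = f + 1`. An isometry carries the core to the vertical axis. There
`γ` becomes `(x, t) ↦ (e^ε L x, e^ε t)` with `L` a linear isometry of `ℂ`, and the tube is the cone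
`|x| < t sinh R`, cut down to `1 ≤ t < e^ε`.

Only the component of `df` along the rays `t ↦ (t z, t)` is kept. With `b = df(z, 1)` and volume `dz
dt / t`, the energy is at least `∫∫ t b² / (1 + |z|²)`, and `t b² ≥ 2b/ε - 1/(ε² t)`. The right side
is linear in `df`, so it integrates along each ray to the increment of `f`. Because of the rotation
`L` this increment need not be 1 on each ray, but its weighted mean over the disc `|z| < sinh R` is
1. What remains is `(1/ε) ∫ dz / (1 + |z|²) = (π/ε) log(1 + sinh² R)`.

The estimate is `le_lintegral_cylinder`; `setLIntegral_le_fundamentalDomain` transfers it to the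
quotient. -/

/-! ### Hyperbolic distance and smooth isometries. -/

/-- The Euclidean square norm on `ℂ × ℝ`. -/
noncomputable def eucl (v : ℂ × ℝ) : ℝ := ‖v.1‖ ^ 2 + v.2 ^ 2

lemma eucl_eq (v : ℂ × ℝ) : eucl v = v.1.re ^ 2 + v.1.im ^ 2 + v.2 ^ 2 := by
  rw [eucl, Complex.sq_norm, Complex.normSq_apply]; ring

lemma eucl_nonneg (v : ℂ × ℝ) : 0 ≤ eucl v := by rw [eucl]; positivity

lemma eucl_smul (r : ℝ) (v : ℂ × ℝ) : eucl (r • v) = r ^ 2 * eucl v := by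
  simp [eucl_eq]; ring

lemma eucl_pos_of_mem {v : ℂ × ℝ} (h : 0 < v.2) : 0 < eucl v := by rw [eucl]; positivity

lemma continuous_eucl : Continuous eucl := by unfold eucl; fun_prop

lemma isOpen_upper : IsOpen upper := isOpen_lt continuous_const continuous_snd

lemma convex_upper : Convex ℝ upper := by
  have : upper = (LinearMap.snd ℝ ℂ ℝ) ⁻¹' Set.Ioi 0 := rfl
  rw [this]
  exact (convex_Ioi 0).linear_preimage _

lemma cosh_arg_ge (p q : H3) : 1 ≤ 1 + eucl (p.1 - q.1) / (2 * p.1.2 * q.1.2) := by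
  have := p.2; have := q.2; have := eucl_nonneg (p.1 - q.1)
  have : 0 ≤ eucl (p.1 - q.1) / (2 * p.1.2 * q.1.2) := by positivity
  linarith

lemma hdist_def' (p q : H3) :
    hdist p q = Real.arcosh (1 + eucl (p.1 - q.1) / (2 * p.1.2 * q.1.2)) := rfl

lemma cosh_hdist (p q : H3) :
    Real.cosh (hdist p q) = 1 + eucl (p.1 - q.1) / (2 * p.1.2 * q.1.2) := by
  rw [hdist_def', Real.cosh_arcosh (cosh_arg_ge p q)]

lemma hdist_nonneg (p q : H3) : 0 ≤ hdist p q := Real.arcosh_nonneg (cosh_arg_ge p q)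

/-- Injectivity of `cosh` on nonnegative reals removes `arcosh`; clearing denominators leaves a
polynomial identity, the form in which isometries are handled below. -/
lemma hdist_eq_iff {p q p' q' : H3} : hdist p q = hdist p' q' ↔
    eucl (p.1 - q.1) * (p'.1.2 * q'.1.2) = eucl (p'.1 - q'.1) * (p.1.2 * q.1.2) := by
  have := p.2; have := q.2; have := p'.2; have := q'.2
  rw [← (Real.cosh_injOn.eq_iff (hdist_nonneg p q) (hdist_nonneg p' q')), cosh_hdist, cosh_hdist,
    add_right_inj, div_eq_div_iff (by positivity) (by positivity)]
  constructor <;> intro h <;> linarith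

lemma extend_apply (φ : H3 → H3) (p : H3) : extend φ p.1 = (φ p).1 := by
  simp [extend, p.2]

lemma extend_of_pos (φ : H3 → H3) {q : ℂ × ℝ} (h : 0 < q.2) : extend φ q = (φ ⟨q, h⟩).1 := by
  simp [extend, h]

lemma extend_mem (φ : H3 → H3) {q : ℂ × ℝ} (h : q ∈ upper) : extend φ q ∈ upper := by
  rw [extend_of_pos φ h]; exact (φ _).2

/-- The group of diffeomorphisms of the upper half-space that preserve the hyperbolic distance. -/
def isomGroup : Subgroup (Equiv.Perm H3) where
  carrier := {φ | (∀ p q, hdist (φ p) (φ q) = hdist p q) ∧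
    ContDiffOn ℝ (⊤ : ℕ∞) (extend φ) upper ∧
    ContDiffOn ℝ (⊤ : ℕ∞) (extend (φ⁻¹ : Equiv.Perm H3)) upper}
  mul_mem' := by
    have key (φ χ : Equiv.Perm H3) (h : ContDiffOn ℝ (⊤ : ℕ∞) (extend φ) upper)
        (h' : ContDiffOn ℝ (⊤ : ℕ∞) (extend χ) upper) :
        ContDiffOn ℝ (⊤ : ℕ∞) (extend (φ * χ : Equiv.Perm H3)) upper := by
      refine (h.comp h' fun q hq => extend_mem _ hq).congr fun q hq => ?_
      rw [Function.comp_apply, extend_of_pos χ hq, extend_apply, extend_of_pos _ hq]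
      rfl
    rintro φ χ ⟨h1, h2, h3⟩ ⟨h1', h2', h3'⟩
    refine ⟨fun p q => ?_, key _ _ h2 h2', ?_⟩
    · rw [Equiv.Perm.mul_apply, Equiv.Perm.mul_apply, h1, h1']
    · rw [mul_inv_rev]; exact key _ _ h3' h3
  one_mem' := by
    have : ContDiffOn ℝ (⊤ : ℕ∞) (extend (1 : Equiv.Perm H3)) upper :=
      contDiffOn_id.congr fun q hq => by rw [extend_of_pos _ hq]; rfl
    exact ⟨fun _ _ => rfl, this, by simpa using this⟩
  inv_mem' := by
    rintro φ ⟨h1, h2, h3⟩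
    refine ⟨fun p q => ?_, h3, by simpa using h2⟩
    rw [← h1]; simp

lemma isomGroup_hdist {φ : Equiv.Perm H3} (h : φ ∈ isomGroup) (p q : H3) :
    hdist (φ p) (φ q) = hdist p q := h.1 p q

lemma isomGroup_contDiffOn {φ : Equiv.Perm H3} (h : φ ∈ isomGroup) :
    ContDiffOn ℝ (⊤ : ℕ∞) (extend φ) upper := h.2.1

lemma isomGroup_hasFDerivAt {φ : Equiv.Perm H3} (h : φ ∈ isomGroup) (p : H3) :
    HasFDerivAt (extend φ) (fderiv ℝ (extend φ) p.1) p.1 :=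
  (((isomGroup_contDiffOn h).contDiffAt (isOpen_upper.mem_nhds p.2)).differentiableAt
    (by simp)).hasFDerivAt

lemma isomGroup_continuous {φ : Equiv.Perm H3} (h : φ ∈ isomGroup) : Continuous φ := by
  refine continuous_induced_rng.2 ?_
  have := continuousOn_iff_continuous_domRestrict.1 (isomGroup_contDiffOn h).continuousOn
  refine this.congr fun p => ?_
  exact extend_apply φ p

lemma IsClosedHyperbolic.le_isomGroup {Γ : Subgroup (Equiv.Perm H3)} (hΓ : IsClosedHyperbolic Γ) :
    Γ ≤ isomGroup := fun φ hφ =>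
  ⟨(hΓ.isometry φ hφ).hdist_eq, (hΓ.isometry φ hφ).smooth,
    (hΓ.isometry _ (Γ.inv_mem hφ)).smooth⟩

/-! ### Conformality and invariance of the pointwise norm. -/

/-- The derivative of an isometry is conformal, with the ratio of heights as its factor. -/
lemma eucl_fderiv {φ : Equiv.Perm H3} (h : φ ∈ isomGroup) (p : H3) (v : ℂ × ℝ) :
    eucl (fderiv ℝ (extend φ) p.1 v) * p.1.2 ^ 2 = eucl v * (φ p).1.2 ^ 2 := by
  have hd := (isomGroup_hasFDerivAt h p).hasLineDerivAt v
  have hcont : ContinuousAt (extend φ) p.1 := (isomGroup_hasFDerivAt h p).continuousAt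
  have hs := hd.tendsto_slope_zero
  have hline : Tendsto (fun r : ℝ => p.1 + r • v) (𝓝[≠] 0) (𝓝 p.1) := by
    have : Continuous (fun r : ℝ => p.1 + r • v) := by fun_prop
    have h0 := this.tendsto 0
    simp only [zero_smul, add_zero] at h0
    exact h0.mono_left nhdsWithin_le_nhds
  have hup : ∀ᶠ r : ℝ in 𝓝[≠] 0, p.1 + r • v ∈ upper :=
    hline.eventually (isOpen_upper.mem_nhds p.2)
  -- The distance identity for `p + r v` and `p`, divided by `r²`, is passed to the limit `r → 0`.
  have L1 : Tendsto (fun r : ℝ => eucl (r⁻¹ • (extend φ (p.1 + r • v) - extend φ p.1)) *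
      ((p.1 + r • v).2 * p.1.2)) (𝓝[≠] 0)
      (𝓝 (eucl (fderiv ℝ (extend φ) p.1 v) * (p.1.2 * p.1.2))) := by
    refine ((continuous_eucl.tendsto _).comp hs).mul
      (((continuous_snd.tendsto _).comp hline).mul tendsto_const_nhds)
  have L2 : Tendsto (fun r : ℝ => eucl v * ((extend φ (p.1 + r • v)).2 * (φ p).1.2)) (𝓝[≠] 0)
      (𝓝 (eucl v * ((φ p).1.2 * (φ p).1.2))) := by
    refine tendsto_const_nhds.mul (Tendsto.mul ?_ tendsto_const_nhds)
    rw [← extend_apply]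
    exact (continuous_snd.tendsto _).comp (hcont.tendsto.comp hline)
  have he : ∀ᶠ r : ℝ in 𝓝[≠] 0, eucl (r⁻¹ • (extend φ (p.1 + r • v) - extend φ p.1)) *
      ((p.1 + r • v).2 * p.1.2) = eucl v * ((extend φ (p.1 + r • v)).2 * (φ p).1.2) := by
    filter_upwards [hup, self_mem_nhdsWithin] with r hr hr0
    have hr0 : r ≠ 0 := hr0
    have := hdist_eq_iff.1 (isomGroup_hdist h ⟨_, hr⟩ p)
    rw [← extend_apply, ← extend_apply] at this
    simp only [add_sub_cancel_left, eucl_smul] at this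
    rw [eucl_smul, mul_assoc, this, extend_apply]
    field_simp
  have := tendsto_nhds_unique (L1.congr' he) L2
  simpa [sq] using this

lemma det_eq_matrix (A : ℂ × ℝ →L[ℝ] ℂ × ℝ) : A.det = Matrix.det
    !![(A (1, 0)).1.re, (A (Complex.I, 0)).1.re, (A (0, 1)).1.re;
      (A (1, 0)).1.im, (A (Complex.I, 0)).1.im, (A (0, 1)).1.im;
      (A (1, 0)).2, (A (Complex.I, 0)).2, (A (0, 1)).2] := by
  let b : Module.Basis (Fin 3) ℝ (ℂ × ℝ) :=
    (Complex.basisOneI.prod (Module.Basis.singleton (Fin 1) ℝ)).reindex finSumFinEquiv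
  rw [ContinuousLinearMap.det, ← LinearMap.det_toMatrix b]
  have e0 : finSumFinEquiv.symm (0 : Fin 3) = (Sum.inl 0 : Fin 2 ⊕ Fin 1) := rfl
  have e1 : finSumFinEquiv.symm (1 : Fin 3) = (Sum.inl 1 : Fin 2 ⊕ Fin 1) := rfl
  have e2 : finSumFinEquiv.symm (2 : Fin 3) = (Sum.inr 0 : Fin 2 ⊕ Fin 1) := rfl
  congr 1
  ext i j
  fin_cases i <;> fin_cases j <;>
    simp [LinearMap.toMatrix_apply, b, e0, e1, e2, Module.Basis.prod_apply]

lemma eucl_polar (u v : ℂ × ℝ) : eucl (u + v) - eucl u - eucl v =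
    2 * (u.1.re * v.1.re + u.1.im * v.1.im + u.2 * v.2) := by
  simp only [eucl_eq, Prod.fst_add, Prod.snd_add, Complex.add_re, Complex.add_im]; ring

/-- A linear map that scales the Euclidean square norm by `k` has determinant `± k ^ (3 / 2)`. -/
lemma det_sq_of_eucl {A : ℂ × ℝ →L[ℝ] ℂ × ℝ} {k : ℝ} (h : ∀ v, eucl (A v) = k * eucl v) :
    A.det ^ 2 = k ^ 3 := by
  have hp (u v : ℂ × ℝ) : (A u).1.re * (A v).1.re + (A u).1.im * (A v).1.im + (A u).2 * (A v).2 =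
      k * (u.1.re * v.1.re + u.1.im * v.1.im + u.2 * v.2) := by
    have h1 := eucl_polar (A u) (A v)
    have h2 := eucl_polar u v
    rw [← map_add, h, h, h] at h1
    linear_combination (-1 / 2 : ℝ) * h1 + (k / 2) * h2
  rw [det_eq_matrix]
  set M : Matrix (Fin 3) (Fin 3) ℝ :=
    !![(A (1, 0)).1.re, (A (Complex.I, 0)).1.re, (A (0, 1)).1.re;
      (A (1, 0)).1.im, (A (Complex.I, 0)).1.im, (A (0, 1)).1.im;
      (A (1, 0)).2, (A (Complex.I, 0)).2, (A (0, 1)).2] with hM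
  have hMM : M.transpose * M = k • (1 : Matrix (Fin 3) (Fin 3) ℝ) := by
    ext i j
    fin_cases i <;> fin_cases j <;>
      simp [hM, Matrix.mul_apply, Fin.sum_univ_three, hp]
  have := congrArg Matrix.det hMM
  rw [Matrix.det_mul, Matrix.det_transpose, Matrix.det_smul, Matrix.det_one] at this
  simpa [sq] using this

lemma abs_det_fderiv {φ : Equiv.Perm H3} (h : φ ∈ isomGroup) (p : H3) :
    |(fderiv ℝ (extend φ) p.1).det| = ((φ p).1.2 / p.1.2) ^ 3 := by
  have hp := p.2
  have hq := (φ p).2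
  have := det_sq_of_eucl (A := fderiv ℝ (extend φ) p.1) (k := ((φ p).1.2 / p.1.2) ^ 2) fun v => by
    have := eucl_fderiv h p v
    field_simp
    linarith
  rw [← sq_eq_sq₀ (abs_nonneg _) (by positivity), sq_abs, this]
  ring

lemma covector_cauchy_schwarz (β : ℂ × ℝ →L[ℝ] ℝ) (v : ℂ × ℝ) :
    β v ^ 2 ≤ (β (1, 0) ^ 2 + β (Complex.I, 0) ^ 2 + β (0, 1) ^ 2) * eucl v := by
  have hv : v = v.1.re • ((1 : ℂ), (0 : ℝ)) + v.1.im • (Complex.I, (0 : ℝ)) + v.2 • ((0 : ℂ), (1 : ℝ)) := by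
    ext <;> simp
  have : β v = v.1.re * β (1, 0) + v.1.im * β (Complex.I, 0) + v.2 * β (0, 1) := by
    conv_lhs => rw [hv]
    simp only [map_add, map_smul, smul_eq_mul]
  rw [this, eucl_eq]
  nlinarith [sq_nonneg (v.1.re * β (Complex.I, 0) - v.1.im * β (1, 0)),
    sq_nonneg (v.1.re * β (0, 1) - v.2 * β (1, 0)),
    sq_nonneg (v.1.im * β (0, 1) - v.2 * β (Complex.I, 0))]

lemma normSqAt_eq (α : ℂ × ℝ → (ℂ × ℝ →L[ℝ] ℝ)) (p : H3) : normSqAt α p =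
    p.1.2 ^ 2 * (α p.1 (1, 0) ^ 2 + α p.1 (Complex.I, 0) ^ 2 + α p.1 (0, 1) ^ 2) := by
  rw [normSqAt]; ring

lemma normSqAt_nonneg (α : ℂ × ℝ → (ℂ × ℝ →L[ℝ] ℝ)) (p : H3) : 0 ≤ normSqAt α p := by
  rw [normSqAt]; positivity

lemma le_normSqAt (α : ℂ × ℝ → (ℂ × ℝ →L[ℝ] ℝ)) (p : H3) (v : ℂ × ℝ) :
    p.1.2 ^ 2 * α p.1 v ^ 2 ≤ normSqAt α p * eucl v := by
  have := mul_le_mul_of_nonneg_left (covector_cauchy_schwarz (α p.1) v) (sq_nonneg p.1.2)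
  rw [normSqAt_eq]; linarith

/-- Evaluate on the Euclidean gradient `v` of `α` at `p`: Cauchy–Schwarz is an equality at `p` and
an inequality at `φ p` for the image of `v`. The reverse bound comes from `φ⁻¹`. -/
lemma normSqAt_le_of_comp {φ : Equiv.Perm H3} (h : φ ∈ isomGroup)
    {α : ℂ × ℝ → (ℂ × ℝ →L[ℝ] ℝ)} {p : H3}
    (hα : (α (φ p).1).comp (fderiv ℝ (extend φ) p.1) = α p.1) :
    normSqAt α p ≤ normSqAt α (φ p) := by
  set β := α p.1 with hβ
  set v : ℂ × ℝ := (⟨β (1, 0), β (Complex.I, 0)⟩, β (0, 1)) with hv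
  set n := eucl v with hn
  have hn' : n = β (1, 0) ^ 2 + β (Complex.I, 0) ^ 2 + β (0, 1) ^ 2 := by rw [hn, eucl_eq]
  have hβv : β v = n := by
    have hv' : v = β (1, 0) • ((1 : ℂ), (0 : ℝ)) + β (Complex.I, 0) • (Complex.I, (0 : ℝ)) +
        β (0, 1) • ((0 : ℂ), (1 : ℝ)) := by
      apply Prod.ext
      · apply Complex.ext <;> simp [hv]
      · simp [hv]
    conv_lhs => rw [hv']
    rw [hn']; simp only [map_add, map_smul, smul_eq_mul]; ring
  have hp := p.2
  have hq := (φ p).2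
  have h1 := le_normSqAt α (φ p) (fderiv ℝ (extend φ) p.1 v)
  have h2 := eucl_fderiv h p v
  have h3 : α (φ p).1 (fderiv ℝ (extend φ) p.1 v) = n := by
    rw [← hβv, ← hα]; rfl
  rw [h3] at h1
  rw [normSqAt_eq, ← hβ, ← hn']
  rcases (eucl_nonneg v).eq_or_lt with h0 | h0
  · rw [hn, ← h0, mul_zero]; exact normSqAt_nonneg _ _
  · refine le_of_mul_le_mul_right ?_ (show 0 < n * (φ p).1.2 ^ 2 by positivity)
    calc p.1.2 ^ 2 * n * (n * (φ p).1.2 ^ 2) = ((φ p).1.2 ^ 2 * n ^ 2) * p.1.2 ^ 2 := by ring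
      _ ≤ (normSqAt α (φ p) * eucl (fderiv ℝ (extend φ) p.1 v)) * p.1.2 ^ 2 := by gcongr
      _ = normSqAt α (φ p) * (n * (φ p).1.2 ^ 2) := by rw [mul_assoc, h2]

lemma normSqAt_invariant {Γ : Subgroup (Equiv.Perm H3)} (hΓ : Γ ≤ isomGroup)
    {α : ℂ × ℝ → (ℂ × ℝ →L[ℝ] ℝ)} (hα : IsOneForm Γ α) {φ : Equiv.Perm H3} (hφ : φ ∈ Γ) (p : H3) :
    normSqAt α (φ p) = normSqAt α p := by
  refine le_antisymm ?_ (normSqAt_le_of_comp (hΓ hφ) (hα.invariant φ hφ p))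
  have := normSqAt_le_of_comp (hΓ (Γ.inv_mem hφ)) (hα.invariant _ (Γ.inv_mem hφ) (φ p))
  simpa using this

/-! ### Invariance of the hyperbolic volume. -/

lemma measurableEmbedding_val : MeasurableEmbedding (Subtype.val : H3 → ℂ × ℝ) :=
  MeasurableEmbedding.subtype_coe isOpen_upper.measurableSet

lemma setLIntegral_hvol {s : Set H3} (hs : MeasurableSet s) (g : ℂ × ℝ → ENNReal) :
    ∫⁻ p in s, g p.1 ∂hvol =
      ∫⁻ q in Subtype.val '' s, ENNReal.ofReal (1 / q.2 ^ 3) * g q := by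
  have hm : Measurable fun p : H3 => ENNReal.ofReal (1 / p.1.2 ^ 3) := by fun_prop
  rw [hvol, restrict_withDensity hs, lintegral_withDensity_eq_lintegral_mul_non_measurable _ hm
    (by simp)]
  have := (measurableEmbedding_val.lintegral_map (μ := (Measure.comap Subtype.val (volume : Measure (ℂ × ℝ))).restrict s)
    (fun q : ℂ × ℝ => ENNReal.ofReal (1 / q.2 ^ 3) * g q)).symm
  simp only [Pi.mul_apply]
  rw [this]
  congr 1
  rw [measurableEmbedding_val.restrict_comap, measurableEmbedding_val.map_comap,
    Measure.restrict_restrict measurableEmbedding_val.measurableSet_range,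
    Set.inter_eq_right.2 (Set.image_subset_range _ _)]

lemma hvol_eq_setLIntegral {s : Set H3} (hs : MeasurableSet s) :
    hvol s = ∫⁻ q in Subtype.val '' s, ENNReal.ofReal (1 / q.2 ^ 3) := by
  simpa using setLIntegral_hvol hs fun _ => 1

instance instIsAddHaarMeasureVolume : (volume : Measure (ℂ × ℝ)).IsAddHaarMeasure :=
  inferInstanceAs ((volume : Measure ℂ).prod (volume : Measure ℝ)).IsAddHaarMeasure

/-- The Jacobian is the cube of the height ratio, which exactly cancels the change of the density `1
/ t³`. -/
lemma hvol_image {φ : Equiv.Perm H3} (h : φ ∈ isomGroup) {s : Set H3} (hs : MeasurableSet s) :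
    hvol (φ '' s) = hvol s := by
  have hs' : MeasurableSet (φ '' s) := by
    rw [Equiv.image_eq_preimage_symm]
    exact (isomGroup_continuous (isomGroup.inv_mem h)).measurable hs
  have himage : (Subtype.val '' (φ '' s) : Set (ℂ × ℝ)) = extend φ '' (Subtype.val '' s) := by
    rw [Set.image_image, Set.image_image]
    exact Set.image_congr fun p _ => (extend_apply φ p).symm
  rw [hvol_eq_setLIntegral hs', hvol_eq_setLIntegral hs, himage,
    lintegral_image_eq_lintegral_abs_det_fderiv_mul volume
      (measurableEmbedding_val.measurableSet_image.2 hs) (f' := fderiv ℝ (extend φ))]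
  · refine setLIntegral_congr_fun (measurableEmbedding_val.measurableSet_image.2 hs) ?_
    rintro _ ⟨p, hp, rfl⟩
    have hp := p.2
    have hq := (φ p).2
    simp only
    rw [abs_det_fderiv h, extend_apply, ← ENNReal.ofReal_mul (by positivity)]
    congr 1
    field_simp
  · rintro _ ⟨p, hp, rfl⟩
    exact (isomGroup_hasFDerivAt h p).hasFDerivWithinAt
  · rintro _ ⟨p, hp, rfl⟩ _ ⟨q, hq, rfl⟩ he
    rw [extend_apply, extend_apply] at he
    rw [φ.injective (Subtype.ext he)]

lemma isomGroup_measurePreserving {φ : Equiv.Perm H3} (h : φ ∈ isomGroup) :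
    MeasurePreserving φ hvol hvol := by
  have hm := (isomGroup_continuous h).measurable
  refine ⟨hm, Measure.ext fun s hs => ?_⟩
  rw [Measure.map_apply hm hs, ← hvol_image h (hm hs), Equiv.image_preimage]

/-! ### Explicit isometries and straightening of geodesics. -/

lemma mem_isomGroup {φ : Equiv.Perm H3} {F G : ℂ × ℝ → ℂ × ℝ}
    (hF : ContDiffOn ℝ (⊤ : ℕ∞) F upper) (hG : ContDiffOn ℝ (⊤ : ℕ∞) G upper)
    (hφ : ∀ p, (φ p).1 = F p.1) (hφ' : ∀ p, (φ.symm p).1 = G p.1)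
    (h : ∀ p q : H3, eucl (F p.1 - F q.1) * (p.1.2 * q.1.2) =
      eucl (p.1 - q.1) * ((F p.1).2 * (F q.1).2)) : φ ∈ isomGroup := by
  refine ⟨fun p q => ?_, hF.congr fun q hq => ?_, hG.congr fun q hq => ?_⟩
  · rw [hdist_eq_iff, hφ, hφ, h]
  · rw [extend_of_pos _ hq, hφ]
  · rw [extend_of_pos _ hq]; exact hφ' _

/-- The horizontal translation by `a`. -/
noncomputable def translation (a : ℂ) : Equiv.Perm H3 where
  toFun p := ⟨(p.1.1 + a, p.1.2), p.2⟩
  invFun p := ⟨(p.1.1 - a, p.1.2), p.2⟩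
  left_inv p := by simp
  right_inv p := by simp

/-- The dilation by `k`. -/
noncomputable def dilation (k : ℝ) (hk : 0 < k) : Equiv.Perm H3 where
  toFun p := ⟨k • p.1, mul_pos hk p.2⟩
  invFun p := ⟨k⁻¹ • p.1, mul_pos (inv_pos.2 hk) p.2⟩
  left_inv p := by
    apply Subtype.ext
    simp only [smul_smul, inv_mul_cancel₀ hk.ne', one_smul]
  right_inv p := by
    apply Subtype.ext
    simp only [smul_smul, mul_inv_cancel₀ hk.ne', one_smul]

lemma inversion_pos (p : H3) : 0 < ((eucl p.1)⁻¹ • p.1).2 :=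
  mul_pos (inv_pos.2 (eucl_pos_of_mem p.2)) p.2

/-- The inversion in the unit sphere. -/
noncomputable def inversion : Equiv.Perm H3 :=
  have h : Function.Involutive fun p : H3 => (⟨(eucl p.1)⁻¹ • p.1, inversion_pos p⟩ : H3) := by
    intro p
    have := eucl_pos_of_mem p.2
    apply Subtype.ext
    simp only [smul_smul, eucl_smul]
    rw [show ((eucl p.1)⁻¹ ^ 2 * eucl p.1)⁻¹ * (eucl p.1)⁻¹ = 1 by field_simp, one_smul]
  h.toPerm

lemma inversion_apply (p : H3) : (inversion p).1 = (eucl p.1)⁻¹ • p.1 := rfl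

lemma translation_mem (a : ℂ) : translation a ∈ isomGroup := by
  refine mem_isomGroup (F := fun q => (q.1 + a, q.2)) (G := fun q => (q.1 - a, q.2))
    (ContDiff.contDiffOn (by fun_prop)) (ContDiff.contDiffOn (by fun_prop)) (fun p => rfl)
    (fun p => rfl) fun p q => ?_
  simp [eucl_eq]

lemma dilation_mem (k : ℝ) (hk : 0 < k) : dilation k hk ∈ isomGroup := by
  refine mem_isomGroup (F := fun q => k • q) (G := fun q => k⁻¹ • q)
    (ContDiff.contDiffOn (by fun_prop)) (ContDiff.contDiffOn (by fun_prop)) (fun p => rfl)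
    (fun p => rfl) fun p q => ?_
  rw [← smul_sub, eucl_smul]
  simp only [Prod.smul_snd, smul_eq_mul]
  ring

lemma inversion_mem : inversion ∈ isomGroup := by
  have hs : ContDiffOn ℝ (⊤ : ℕ∞) (fun q : ℂ × ℝ => (eucl q)⁻¹ • q) upper := by
    refine ContDiffOn.smul (ContDiffOn.inv ?_ fun q hq => (eucl_pos_of_mem hq).ne') contDiffOn_id
    refine ContDiff.contDiffOn ?_
    unfold eucl
    exact ((contDiff_norm_sq ℝ).comp contDiff_fst).add (contDiff_snd.pow 2)
  refine mem_isomGroup hs hs (fun p => rfl) (fun p => rfl) fun p q => ?_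
  have hp := eucl_pos_of_mem p.2
  have hq := eucl_pos_of_mem q.2
  have key : eucl ((eucl p.1)⁻¹ • p.1 - (eucl q.1)⁻¹ • q.1) * (eucl p.1 * eucl q.1) =
      eucl (p.1 - q.1) := by
    have h1 := eucl_polar ((eucl p.1)⁻¹ • p.1) (-((eucl q.1)⁻¹ • q.1))
    have h2 := eucl_polar p.1 (-q.1)
    rw [← neg_smul, eucl_smul, eucl_smul] at h1
    rw [← neg_one_smul ℝ q.1, eucl_smul] at h2
    simp only [Prod.smul_fst, Prod.smul_snd, smul_eq_mul, Complex.smul_re, Complex.smul_im] at h1 h2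
    rw [sub_eq_add_neg, ← neg_smul, sub_eq_add_neg, ← neg_one_smul ℝ q.1]
    rw [sub_eq_iff_eq_add, sub_eq_iff_eq_add] at h1 h2
    rw [h1, h2]
    field_simp
    ring
  rw [← key]
  simp only [Prod.smul_snd, smul_eq_mul]
  field_simp

/-- The vertical geodesic over `0`. -/
noncomputable def axis (s : ℝ) : H3 := ⟨(0, Real.exp s), Real.exp_pos s⟩

/-- For given distances this is linear in `eucl p` and the height, so two points of the axis
determine both. -/
lemma cosh_hdist_axis (p : H3) (u : ℝ) :
    Real.cosh (hdist p (axis u)) * (2 * p.1.2 * Real.exp u) = eucl p.1 + Real.exp u ^ 2 := by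
  have := p.2
  have := Real.exp_pos u
  rw [cosh_hdist]
  simp only [axis, eucl, Prod.fst_sub, Prod.snd_sub, sub_zero]
  field_simp
  ring

lemma exists_isom_vertical (p q : H3) :
    ∃ φ ∈ isomGroup, (φ p).1.1 = 0 ∧ (φ q).1.1 = 0 := by
  have hp := p.2
  have hq := q.2
  by_cases hx : p.1.1 = q.1.1
  · exact ⟨_, translation_mem (-p.1.1), by simp [translation], by simp [translation, hx]⟩
  set d : ℂ := p.1.1 - q.1.1 with hd
  have hD : 0 < ‖d‖ ^ 2 := by
    have : d ≠ 0 := sub_ne_zero.2 hx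
    positivity
  -- The roots locate the two ends of the semicircle through `p` and `q` orthogonal to the boundary.
  -- Inversion centred at an end turns it into a vertical line.
  obtain ⟨l, hl⟩ := exists_quadratic_eq_zero (a := ‖d‖ ^ 2)
    (b := ‖d‖ ^ 2 + q.1.2 ^ 2 - p.1.2 ^ 2) (c := -p.1.2 ^ 2) hD.ne'
    ⟨√(discrim _ _ _), (Real.mul_self_sqrt (by
      rw [discrim]
      nlinarith [sq_nonneg (‖d‖ ^ 2 + q.1.2 ^ 2 - p.1.2 ^ 2), mul_pos hD (pow_pos hp 2)])).symm⟩
  set χ : Equiv.Perm H3 := inversion * translation (l • (-d) - p.1.1) with hχ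
  have e1 : (χ p).1.1 = (‖l • d‖ ^ 2 + p.1.2 ^ 2)⁻¹ • (l • (-d)) := by
    simp [hχ, inversion, translation, eucl]
  have e2 : (χ q).1.1 = (‖(1 + l) • d‖ ^ 2 + q.1.2 ^ 2)⁻¹ • ((1 + l) • (-d)) := by
    have : q.1.1 + (l • (-d) - p.1.1) = (1 + l) • (-d) := by
      simp [hd]; ring
    simp only [hχ, Equiv.Perm.mul_apply, inversion, translation, eucl, Equiv.coe_fn_mk,
      Function.Involutive.coe_toPerm, Prod.smul_fst]
    rw [this, smul_neg, norm_neg]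
  have he : (χ p).1.1 = (χ q).1.1 := by
    rw [e1, e2, smul_smul, smul_smul]
    congr 1
    simp only [norm_smul, mul_pow, Real.norm_eq_abs, sq_abs]
    have h1 : 0 < l ^ 2 * ‖d‖ ^ 2 + p.1.2 ^ 2 := by positivity
    have h2 : 0 < (1 + l) ^ 2 * ‖d‖ ^ 2 + q.1.2 ^ 2 := by positivity
    field_simp
    linarith
  refine ⟨translation (-(χ p).1.1) * χ, isomGroup.mul_mem (translation_mem _)
    (isomGroup.mul_mem inversion_mem (translation_mem _)), ?_, ?_⟩
  · simp [translation]
  · simp [translation, he]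

lemma eq_axis_of_isGeodesicLine {c : ℝ → H3} (hc : IsGeodesicLine c) (h0 : c 0 = axis 0)
    (h1 : c 1 = axis 1) (s : ℝ) : c s = axis s := by
  have e0 := cosh_hdist_axis (c s) 0
  have e1 := cosh_hdist_axis (c s) 1
  rw [← h0, hc, Real.cosh_abs] at e0
  rw [← h1, hc, Real.cosh_abs] at e1
  have hs := Real.exp_pos s
  have h2 : Real.exp 1 ^ 2 - 1 > 0 := by
    nlinarith [Real.add_one_lt_exp (x := 1) one_ne_zero]
  simp only [sub_zero, Real.exp_zero, one_pow, mul_one] at e0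
  rw [Real.cosh_eq] at e0 e1
  rw [Real.exp_neg] at e0
  rw [neg_sub, Real.exp_sub, Real.exp_sub] at e1
  have hE := Real.exp_pos 1
  set t := (c s).1.2 with ht
  have htp : 0 < t := (c s).2
  have e0' : (Real.exp s ^ 2 + 1) * t = (eucl (c s).1 + 1) * Real.exp s := by
    field_simp at e0; linarith
  have e1' : (Real.exp s ^ 2 + Real.exp 1 ^ 2) * t =
      (eucl (c s).1 + Real.exp 1 ^ 2) * Real.exp s := by
    field_simp at e1; linarith
  have ht' : t = Real.exp s := by
    have : (Real.exp 1 ^ 2 - 1) * t = (Real.exp 1 ^ 2 - 1) * Real.exp s := by linarith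
    exact mul_left_cancel₀ h2.ne' this
  have hW : eucl (c s).1 = t ^ 2 := by
    rw [← ht'] at e0'
    have : (t ^ 2 + 1) * t = (eucl (c s).1 + 1) * t := e0'
    have := mul_right_cancel₀ htp.ne' this
    linarith
  have hx : (c s).1.1 = 0 := by
    rw [eucl, ← ht] at hW
    have : ‖(c s).1.1‖ ^ 2 = 0 := by linarith
    simpa using this
  exact Subtype.ext (Prod.ext hx ht')

lemma IsGeodesicLine.comp {c : ℝ → H3} (hc : IsGeodesicLine c) {φ : Equiv.Perm H3}
    (hφ : φ ∈ isomGroup) : IsGeodesicLine fun s => φ (c s) := fun s t => by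
  rw [isomGroup_hdist hφ, hc]

/-- Every geodesic line is the image of the vertical one under an isometry. -/
lemma IsGeodesicLine.exists_isom {c : ℝ → H3} (hc : IsGeodesicLine c) :
    ∃ ψ ∈ isomGroup, ∀ s, c s = ψ (axis s) := by
  suffices h : ∃ φ ∈ isomGroup, φ (c 0) = axis 0 ∧ φ (c 1) = axis 1 by
    obtain ⟨φ, hφ, h0, h1⟩ := h
    refine ⟨φ⁻¹, isomGroup.inv_mem hφ, fun s => ?_⟩
    rw [← eq_axis_of_isGeodesicLine (hc.comp hφ) h0 h1 s]
    simp
  obtain ⟨φ, hφ, h0, h1⟩ := exists_isom_vertical (c 0) (c 1)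
  have ha := (φ (c 0)).2
  have hb := (φ (c 1)).2
  set a := (φ (c 0)).1.2 with hadef
  set χ := dilation a⁻¹ (inv_pos.2 ha) * φ with hχdef
  have hχ : χ ∈ isomGroup := isomGroup.mul_mem (dilation_mem _ _) hφ
  have h0' : χ (c 0) = axis 0 := by
    apply Subtype.ext
    apply Prod.ext
    · simp [hχdef, dilation, h0, axis]
    · simp [hχdef, dilation, axis, ← hadef, ha.ne']
  have h1' : (χ (c 1)).1.1 = 0 := by simp [hχdef, dilation, h1]
  have hu := (χ (c 1)).2
  have hE := Real.exp_pos 1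
  have hd := (hc.comp hχ) 1 0
  have := cosh_hdist_axis (χ (c 1)) 0
  rw [← h0', hd, eucl, h1'] at this
  simp only [sub_zero, Real.exp_zero, abs_one, Real.cosh_eq, Real.exp_neg, norm_zero] at this
  have hf : ((χ (c 1)).1.2 - Real.exp 1) * ((χ (c 1)).1.2 - (Real.exp 1)⁻¹) = 0 := by
    field_simp at this ⊢
    linarith
  rcases mul_eq_zero.1 hf with h | h
  · exact ⟨χ, hχ, h0', Subtype.ext (Prod.ext h1' (sub_eq_zero.1 h))⟩
  -- The second point landed at height `e⁻¹`; the inversion fixes `axis 0` and reverses the axis.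
  · refine ⟨inversion * χ, isomGroup.mul_mem inversion_mem hχ, ?_, ?_⟩
    · rw [Equiv.Perm.mul_apply, h0']
      apply Subtype.ext
      simp [inversion, axis, eucl]
    · have h := sub_eq_zero.1 h
      apply Subtype.ext
      apply Prod.ext
      · simp [inversion_apply, h1', axis]
      · rw [Equiv.Perm.mul_apply, inversion_apply, Prod.smul_snd, eucl, h1', h]
        simp [axis]
        field_simp
        rw [sq, ← Real.exp_add]
        norm_num

/-- An isometry translating the vertical geodesic over `0` is a dilation composed with a linear
isometry of `ℂ`. -/
lemma exists_linearIsometry_of_axis {g : Equiv.Perm H3} (hg : g ∈ isomGroup) {ε : ℝ}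
    (h : ∀ s, g (axis s) = axis (s + ε)) :
    ∃ L : ℂ ≃ₗᵢ[ℝ] ℂ, ∀ p, (g p).1 = (Real.exp ε • L p.1.1, Real.exp ε * p.1.2) := by
  have hE := Real.exp_pos ε
  have height (p : H3) : (g p).1.2 = Real.exp ε * p.1.2 := by
    -- Subtracting the cases `u = 0` and `u = 1` eliminates both `eucl` terms.
    have key (u : ℝ) : (eucl (g p).1 + Real.exp (u + ε) ^ 2) * p.1.2 =
        (eucl p.1 + Real.exp u ^ 2) * ((g p).1.2 * Real.exp ε) := by
      have e1 := cosh_hdist_axis p u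
      have e2 := cosh_hdist_axis (g p) (u + ε)
      rw [← h, isomGroup_hdist hg] at e2
      rw [← e1, ← e2, Real.exp_add]
      ring
    have k0 := key 0
    have k1 := key 1
    have h2 : Real.exp 1 ^ 2 - 1 > 0 := by
      nlinarith [Real.add_one_lt_exp (x := 1) one_ne_zero]
    simp only [Real.exp_add, Real.exp_zero] at k0 k1
    have : ((Real.exp 1 ^ 2 - 1) * Real.exp ε) * (g p).1.2 =
        ((Real.exp 1 ^ 2 - 1) * Real.exp ε) * (Real.exp ε * p.1.2) := by linarith
    exact mul_left_cancel₀ (by positivity) this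
  have horiz (p q : H3) : ‖(g p).1.1 - (g q).1.1‖ = Real.exp ε * ‖p.1.1 - q.1.1‖ := by
    have hp := p.2
    have hq := q.2
    have := hdist_eq_iff.1 (isomGroup_hdist hg p q)
    simp only [eucl, Prod.fst_sub, Prod.snd_sub, height] at this
    rw [← sq_eq_sq₀ (norm_nonneg _) (by positivity)]
    have h3 : (‖(g p).1.1 - (g q).1.1‖ ^ 2) * (p.1.2 * q.1.2) =
        ((Real.exp ε * ‖p.1.1 - q.1.1‖) ^ 2) * (p.1.2 * q.1.2) := by linarith
    exact mul_right_cancel₀ (by positivity) h3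
  -- The rescaled action at height 1 is an isometry of `ℂ` fixing 0, hence linear by strict
  -- convexity.
  let l : ℂ → ℂ := fun z => (Real.exp ε)⁻¹ • (g ⟨(z, 1), one_pos⟩).1.1
  have hl : Isometry l := by
    refine Isometry.of_dist_eq fun z w => ?_
    rw [dist_eq_norm, dist_eq_norm, ← smul_sub, norm_smul, horiz, norm_inv, Real.norm_eq_abs,
      abs_of_pos hE]
    field_simp
  have hl0 : l 0 = 0 := by
    have := h 0
    simp only [axis, Real.exp_zero] at this
    simp [l, this]
  let A := hl.affineIsometryOfStrictConvexSpace
  have hA (z : ℂ) : A.linearIsometry z = l z := by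
    have := A.map_vsub z 0
    simpa [A, hl0] using this
  refine ⟨A.linearIsometry.toLinearIsometryEquiv rfl, fun p => Prod.ext ?_ (height p)⟩
  -- The horizontal part of `g p` does not depend on the height of `p`.
  have h4 := horiz p ⟨(p.1.1, 1), one_pos⟩
  simp only [sub_self, norm_zero, mul_zero, norm_eq_zero] at h4
  simp [hA, l, sub_eq_zero.1 h4]

/-! ### The energy estimate in a cylinder. -/

lemma integral_ball_inv_one_add_sq {ρ : ℝ} (hρ : 0 < ρ) :
    ∫ z in Metric.ball (0 : ℂ) ρ, (1 + ‖z‖ ^ 2)⁻¹ = Real.pi * Real.log (1 + ρ ^ 2) := by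
  have h1 : ∫ z in Metric.ball (0 : ℂ) ρ, (1 + ‖z‖ ^ 2)⁻¹ =
      ∫ z : ℂ, (Set.Iio ρ).indicator (fun r : ℝ => (1 + r ^ 2)⁻¹) ‖z‖ := by
    rw [← integral_indicator measurableSet_ball]
    congr 1 with z
    simp [Set.indicator]
  have h2 : ∫ r in Set.Ioi (0 : ℝ), r • (Set.Iio ρ).indicator (fun r : ℝ => (1 + r ^ 2)⁻¹) r =
      ∫ r in (0 : ℝ)..ρ, r * (1 + r ^ 2)⁻¹ := by
    rw [intervalIntegral.integral_of_le hρ.le, integral_Ioc_eq_integral_Ioo,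
      ← Set.Ioi_inter_Iio, ← setIntegral_indicator measurableSet_Iio]
    congr 1 with r
    simp [Set.indicator]
  have h3 : ∫ r in (0 : ℝ)..ρ, r * (1 + r ^ 2)⁻¹ = Real.log (1 + ρ ^ 2) / 2 := by
    have hd (r : ℝ) : HasDerivAt (fun r : ℝ => Real.log (1 + r ^ 2) / 2) (r * (1 + r ^ 2)⁻¹) r := by
      have : HasDerivAt (fun r : ℝ => 1 + r ^ 2) (2 * r) r := by
        simpa using (hasDerivAt_pow 2 r).const_add 1
      refine ((this.log (by positivity)).div_const 2).congr_deriv ?_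
      field_simp
    rw [intervalIntegral.integral_eq_sub_of_hasDerivAt (fun r _ => hd r)]
    · simp
    · refine (Continuous.mul continuous_id (Continuous.inv₀ (by fun_prop) fun r => ?_)).intervalIntegrable _ _
      positivity
  have hb : (volume : Measure ℂ).real (Metric.ball 0 1) = Real.pi := by
    simp [Measure.real, Complex.volume_ball]
  rw [h1, integral_fun_norm_addHaar, Complex.finrank_real_complex, hb]
  simp only [Nat.add_one_sub_one, pow_one]
  rw [h2, h3]
  simp
  ring

section Cylinder

variable {f : ℂ × ℝ → ℝ} {ω : ℂ × ℝ → (ℂ × ℝ →L[ℝ] ℝ)} {L : ℂ ≃ₗᵢ[ℝ] ℂ} {ε ρ : ℝ}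

/-- The density whose integral bounds the energy of the form in the tube from below. -/
noncomputable def tubeDensity (ω : ℂ × ℝ → (ℂ × ℝ →L[ℝ] ℝ)) (ε : ℝ) (q : ℂ × ℝ) : ℝ :=
  (2 / ε * ω (q.2 • q.1, q.2) (q.1, 1) - 1 / ε ^ 2 * q.2⁻¹) * (1 + ‖q.1‖ ^ 2)⁻¹

lemma continuousOn_tubeDensity (hω : ContinuousOn ω upper) :
    ContinuousOn (tubeDensity ω ε) upper := by
  have h1 : ContinuousOn (fun q : ℂ × ℝ => ω (q.2 • q.1, q.2)) upper :=
    hω.comp (Continuous.continuousOn (by fun_prop)) fun q hq => hq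
  have h2 : ContinuousOn (fun q : ℂ × ℝ => ω (q.2 • q.1, q.2) (q.1, 1)) upper :=
    h1.clm_apply (Continuous.continuousOn (by fun_prop))
  have h3 : ContinuousOn (fun q : ℂ × ℝ => q.2⁻¹) upper :=
    continuousOn_snd.inv₀ fun q hq => ne_of_gt hq
  have h4 : Continuous (fun q : ℂ × ℝ => (1 + ‖q.1‖ ^ 2)⁻¹) :=
    Continuous.inv₀ (by fun_prop) fun q => by positivity
  exact ((continuousOn_const.mul h2).sub (continuousOn_const.mul h3)).mul h4.continuousOn

lemma integrableOn_tubeDensity (hω : ContinuousOn ω upper) :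
    IntegrableOn (tubeDensity ω ε) (Metric.ball 0 ρ ×ˢ Set.Ico 1 (Real.exp ε)) := by
  have hc : IsCompact (Metric.closedBall (0 : ℂ) ρ ×ˢ Set.Icc 1 (Real.exp ε)) :=
    (isCompact_closedBall _ _).prod isCompact_Icc
  refine IntegrableOn.mono_set (ContinuousOn.integrableOn_compact hc
    ((continuousOn_tubeDensity hω).mono ?_))
    (Set.prod_mono Metric.ball_subset_closedBall Set.Ico_subset_Icc_self)
  rintro q ⟨-, hq⟩
  exact lt_of_lt_of_le one_pos hq.1

/-- Along `t ↦ (t z, t)` the value `ω (z, 1)` is the derivative of `f`, so the fundamental theorem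
of calculus applies; the logarithm contributes `ε / ε²`. -/
lemma integral_tubeDensity_fiber (hε : 0 < ε) (hω : ContinuousOn ω upper)
    (hf : ∀ q ∈ upper, HasFDerivAt f (ω q) q) (z : ℂ) :
    ∫ t in Set.Ico 1 (Real.exp ε), tubeDensity ω ε (z, t) =
      (2 / ε * (f (Real.exp ε • z, Real.exp ε) - f (z, 1)) - 1 / ε) * (1 + ‖z‖ ^ 2)⁻¹ := by
  have hE : 1 ≤ Real.exp ε := Real.one_le_exp hε.le
  have hd (t : ℝ) (ht : 0 < t) : HasDerivAt
      (fun t : ℝ => (2 / ε * f (t • z, t) - 1 / ε ^ 2 * Real.log t) * (1 + ‖z‖ ^ 2)⁻¹)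
      (tubeDensity ω ε (z, t)) t := by
    have hg : HasDerivAt (fun t : ℝ => (t • z, t)) (z, (1 : ℝ)) t := by
      simpa using ((hasDerivAt_id t).smul_const z).prodMk (hasDerivAt_id t)
    have := HasFDerivAt.comp_hasDerivAt (f := fun t : ℝ => (t • z, t)) t (hf (t • z, t) ht) hg
    exact ((this.const_mul (2 / ε)).sub ((Real.hasDerivAt_log ht.ne').const_mul (1 / ε ^ 2))).mul_const _
  have hpos : ∀ t ∈ Set.uIcc 1 (Real.exp ε), 0 < t := fun t ht => by
    rw [Set.uIcc_of_le hE] at ht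
    exact lt_of_lt_of_le one_pos ht.1
  rw [integral_Ico_eq_integral_Ioo, ← integral_Ioc_eq_integral_Ioo,
    ← intervalIntegral.integral_of_le hE,
    intervalIntegral.integral_eq_sub_of_hasDerivAt (fun t ht => hd t (hpos t ht))]
  · simp only [Real.log_exp, Real.log_one, one_smul]
    field_simp
    ring
  · refine ContinuousOn.intervalIntegrable fun t ht => ContinuousAt.continuousWithinAt ?_
    have : ContinuousAt (tubeDensity ω ε) (z, t) :=
      (continuousOn_tubeDensity hω).continuousAt (isOpen_upper.mem_nhds (hpos t ht))
    exact this.comp (f := fun t : ℝ => (z, t)) (by fun_prop)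

/-- By periodicity the start of the ray over `z` is matched with the end of the ray over `L z`, so
the increment is `1 + F(z) - F(L z)` with `F` the end value. Since `L` preserves the disc, Lebesgue
measure and `1 + |z|²`, the discrepancy integrates to zero. -/
lemma integral_tubeDensity (hε : 0 < ε) (hρ : 0 < ρ) (hω : ContinuousOn ω upper)
    (hf : ∀ q ∈ upper, HasFDerivAt f (ω q) q)
    (hL : ∀ q ∈ upper, f (Real.exp ε • L q.1, Real.exp ε * q.2) = f q + 1) :
    ∫ q in Metric.ball 0 ρ ×ˢ Set.Ico 1 (Real.exp ε), tubeDensity ω ε q =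
      Real.pi / ε * Real.log (1 + ρ ^ 2) := by
  have hE := Real.exp_pos ε
  let k : ℂ → ℝ := fun z => f (Real.exp ε • z, Real.exp ε) * (1 + ‖z‖ ^ 2)⁻¹
  have hw : Continuous fun z : ℂ => (1 + ‖z‖ ^ 2)⁻¹ :=
    Continuous.inv₀ (by fun_prop) fun z => by positivity
  have hk : Continuous k := by
    refine Continuous.mul ?_ hw
    refine continuous_iff_continuousAt.2 fun z => ?_
    exact (hf (Real.exp ε • z, Real.exp ε) hE).continuousAt.comp
      (f := fun z : ℂ => (Real.exp ε • z, Real.exp ε)) (by fun_prop)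
  have hint {g : ℂ → ℝ} (hg : Continuous g) : IntegrableOn g (Metric.ball 0 ρ) :=
    (hg.continuousOn.integrableOn_compact (isCompact_closedBall _ _)).mono_set
      Metric.ball_subset_closedBall
  have hrot : ∫ z in Metric.ball 0 ρ, k (L z) = ∫ z in Metric.ball 0 ρ, k z := by
    have := L.measurePreserving.setIntegral_preimage_emb L.toMeasurableEquiv.measurableEmbedding
      k (Metric.ball 0 ρ)
    rwa [L.preimage_ball, map_zero] at this
  rw [Measure.volume_eq_prod, setIntegral_prod _ (integrableOn_tubeDensity hω)]
  have hfib (z : ℂ) : ∫ t in Set.Ico 1 (Real.exp ε), tubeDensity ω ε (z, t) =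
      1 / ε * (1 + ‖z‖ ^ 2)⁻¹ + 2 / ε * (k z - k (L z)) := by
    have := hL (z, 1) (show (0 : ℝ) < 1 from one_pos)
    simp only [mul_one] at this
    rw [integral_tubeDensity_fiber hε hω hf, ← sub_eq_iff_eq_add.2 this]
    simp only [k, L.norm_map]
    ring
  simp_rw [hfib]
  have hkL : Continuous fun z => k (L z) := hk.comp L.continuous
  have i1 : IntegrableOn (fun z : ℂ => 1 / ε * (1 + ‖z‖ ^ 2)⁻¹) (Metric.ball 0 ρ) :=
    hint (by fun_prop)
  have i2 : IntegrableOn (fun z : ℂ => 2 / ε * (k z - k (L z))) (Metric.ball 0 ρ) :=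
    hint (by fun_prop)
  rw [integral_add i1 i2, integral_const_mul, integral_const_mul,
    integral_sub (hint hk) (hint hkL), hrot, sub_self,
    integral_ball_inv_one_add_sq hρ]
  ring

lemma ofReal_setIntegral_le_setLIntegral {X : Type*} [MeasurableSpace X] {μ : Measure X}
    {g : X → ℝ} {s : Set X} (hg : IntegrableOn g s μ) :
    ENNReal.ofReal (∫ x in s, g x ∂μ) ≤ ∫⁻ x in s, ENNReal.ofReal (g x) ∂μ := by
  rw [integral_eq_lintegral_pos_part_sub_lintegral_neg_part hg]
  refine (ENNReal.ofReal_le_ofReal (sub_le_self _ ENNReal.toReal_nonneg)).trans ?_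
  exact ENNReal.ofReal_toReal_le

/-- The solid cylinder `|x| < ρ t`, `1 ≤ t < e ^ ε`. -/
def cylinder (ε ρ : ℝ) : Set H3 :=
  {p | ‖p.1.1‖ < ρ * p.1.2 ∧ 1 ≤ p.1.2 ∧ p.1.2 < Real.exp ε}

lemma measurableSet_cylinder : MeasurableSet (cylinder ε ρ) := by
  have h1 : Continuous fun p : H3 => ‖p.1.1‖ := by fun_prop
  have h2 : Continuous fun p : H3 => p.1.2 := by fun_prop
  exact (isOpen_lt h1 (h2.const_mul ρ)).measurableSet.inter
    ((isClosed_le continuous_const h2).measurableSet.inter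
      (isOpen_lt h2 continuous_const).measurableSet)

lemma cylinder_image : (Subtype.val '' cylinder ε ρ : Set (ℂ × ℝ)) =
    (fun q : ℂ × ℝ => (q.2 • q.1, q.2)) '' (Metric.ball 0 ρ ×ˢ Set.Ico 1 (Real.exp ε)) := by
  ext q
  constructor
  · rintro ⟨p, ⟨h1, h2, h3⟩, rfl⟩
    have hp := p.2
    refine ⟨(p.1.2⁻¹ • p.1.1, p.1.2), ⟨?_, h2, h3⟩, ?_⟩
    · rw [mem_ball_zero_iff, norm_smul, norm_inv, Real.norm_eq_abs, abs_of_pos hp,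
        inv_mul_lt_iff₀ hp]
      linarith
    · simp only [smul_smul, mul_inv_cancel₀ hp.ne', one_smul]
  · rintro ⟨⟨z, t⟩, ⟨h1, h2, h3⟩, rfl⟩
    have ht : 0 < t := lt_of_lt_of_le one_pos h2
    refine ⟨⟨(t • z, t), ht⟩, ⟨?_, h2, h3⟩, rfl⟩
    rw [mem_ball_zero_iff] at h1
    simp only at h1 ⊢
    rw [norm_smul, Real.norm_eq_abs, abs_of_pos ht, mul_comm]
    gcongr

/-- The substitution `(z, t) ↦ (t z, t)` has Jacobian `t²`, which against `t⁻³` leaves `t⁻¹`. -/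
lemma lintegral_cylinder (g : ℂ × ℝ → ENNReal) :
    ∫⁻ p in cylinder ε ρ, g p.1 ∂hvol =
      ∫⁻ q in Metric.ball 0 ρ ×ˢ Set.Ico 1 (Real.exp ε),
        ENNReal.ofReal q.2⁻¹ * g (q.2 • q.1, q.2) := by
  have hm : MeasurableSet (Metric.ball (0 : ℂ) ρ ×ˢ Set.Ico 1 (Real.exp ε)) :=
    measurableSet_ball.prod measurableSet_Ico
  have hpos {q : ℂ × ℝ} (hq : q ∈ Metric.ball (0 : ℂ) ρ ×ˢ Set.Ico 1 (Real.exp ε)) : 0 < q.2 :=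
    lt_of_lt_of_le one_pos hq.2.1
  let A : ℂ × ℝ → (ℂ × ℝ →L[ℝ] ℂ × ℝ) := fun q =>
    (q.2 • ContinuousLinearMap.fst ℝ ℂ ℝ +
      (ContinuousLinearMap.snd ℝ ℂ ℝ).smulRight q.1).prod (ContinuousLinearMap.snd ℝ ℂ ℝ)
  have hA (q : ℂ × ℝ) : HasFDerivAt (fun q : ℂ × ℝ => (q.2 • q.1, q.2)) (A q) q :=
    ((hasFDerivAt_snd (𝕜 := ℝ) (p := q)).smul (hasFDerivAt_fst (𝕜 := ℝ) (p := q))).prodMk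
      hasFDerivAt_snd
  have hdet (q : ℂ × ℝ) : (A q).det = q.2 ^ 2 := by
    rw [det_eq_matrix, Matrix.det_fin_three]
    simp [A]
    ring
  rw [setLIntegral_hvol measurableSet_cylinder, cylinder_image,
    lintegral_image_eq_lintegral_abs_det_fderiv_mul volume hm
      (fun q _ => (hA q).hasFDerivWithinAt)]
  · refine setLIntegral_congr_fun hm fun q hq => ?_
    have := hpos hq
    simp only [hdet]
    rw [← mul_assoc, ← ENNReal.ofReal_mul (abs_nonneg _), abs_of_nonneg (by positivity)]
    congr 2
    field_simp
  · rintro q hq q' hq' h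
    obtain ⟨h1, h2⟩ : q.2 • q.1 = q'.2 • q'.1 ∧ q.2 = q'.2 := Prod.mk.inj h
    rw [← h2] at h1
    exact Prod.ext (smul_right_injective ℂ (hpos hq).ne' h1) h2

/-- Lower bound for the energy of the axial component of the exact form `df = ω` in a cylinder. -/
lemma le_lintegral_cylinder (hε : 0 < ε) (hρ : 0 < ρ) (hω : ContinuousOn ω upper)
    (hf : ∀ q ∈ upper, HasFDerivAt f (ω q) q)
    (hL : ∀ q ∈ upper, f (Real.exp ε • L q.1, Real.exp ε * q.2) = f q + 1) :
    ENNReal.ofReal (Real.pi / ε * Real.log (1 + ρ ^ 2)) ≤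
      ∫⁻ p in cylinder ε ρ, ENNReal.ofReal (p.1.2 ^ 2 * ω p.1 p.1 ^ 2 / eucl p.1) ∂hvol := by
  rw [lintegral_cylinder fun q => ENNReal.ofReal (q.2 ^ 2 * ω q q ^ 2 / eucl q),
    ← integral_tubeDensity hε hρ hω hf hL]
  refine (ofReal_setIntegral_le_setLIntegral (integrableOn_tubeDensity hω)).trans ?_
  refine setLIntegral_mono' (measurableSet_ball.prod measurableSet_Ico) ?_
  rintro ⟨z, t⟩ ⟨-, ht⟩
  have ht : 0 < t := lt_of_lt_of_le one_pos ht.1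
  simp only [tubeDensity]
  rw [← ENNReal.ofReal_mul (by positivity)]
  refine ENNReal.ofReal_le_ofReal ?_
  have e1 : ω (t • z, t) (t • z, t) = t * ω (t • z, t) (z, 1) := by
    rw [← smul_eq_mul, ← map_smul]; simp
  have e2 : eucl (t • z, t) = t ^ 2 * (1 + ‖z‖ ^ 2) := by
    rw [eucl, norm_smul, mul_pow, Real.norm_eq_abs, sq_abs]; ring
  rw [e1, e2]
  set b := ω (t • z, t) (z, 1)
  have h1 : t⁻¹ * (t ^ 2 * (t * b) ^ 2 / (t ^ 2 * (1 + ‖z‖ ^ 2))) =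
      (t * b ^ 2) * (1 + ‖z‖ ^ 2)⁻¹ := by
    field_simp
  rw [h1]
  gcongr
  -- The density comes from the tangent line to `t b²` at `b = 1/(ε t)`, the value taken by the
  -- model form `d(log |p|) / ε`.
  have h2 : t * b ^ 2 - (2 / ε * b - 1 / ε ^ 2 * t⁻¹) = t * (b - 1 / (ε * t)) ^ 2 := by
    field_simp
    ring
  have h3 : 0 ≤ t * (b - 1 / (ε * t)) ^ 2 := by positivity
  linarith

end Cylinder

/-! ### Compactness and unfolding over a fundamental domain. -/

open scoped Pointwise

variable {Γ : Subgroup (Equiv.Perm H3)}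

lemma isomGroup_measurableEmbedding {φ : Equiv.Perm H3} (h : φ ∈ isomGroup) :
    MeasurableEmbedding φ :=
  (Homeomorph.mk φ (isomGroup_continuous h)
    (isomGroup_continuous (isomGroup.inv_mem h))).measurableEmbedding

lemma continuousConstSMul_of_le (hΓ : Γ ≤ isomGroup) : ContinuousConstSMul Γ H3 :=
  ⟨fun g => isomGroup_continuous (hΓ g.2)⟩

lemma measurableConstSMul_of_le (hΓ : Γ ≤ isomGroup) : MeasurableConstSMul Γ H3 :=
  ⟨fun g => (isomGroup_continuous (hΓ g.2)).measurable⟩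

lemma smulInvariantMeasure_of_le (hΓ : Γ ≤ isomGroup) : SMulInvariantMeasure Γ H3 hvol :=
  ⟨fun g _ hs => (isomGroup_measurePreserving (hΓ g.2)).measure_preimage hs.nullMeasurableSet⟩

instance instLocallyCompactSpaceH3 : LocallyCompactSpace H3 :=
  isOpen_upper.locallyCompactSpace

lemma countable_of_properlyDiscontinuous (h : ProperlyDiscontinuousSMul Γ H3) : Countable Γ := by
  have hu : (Set.univ : Set Γ) = ⋃ n, {g : Γ | ((g • ·) '' {axis 0} ∩ compactCovering H3 n).Nonempty} := by
    refine (Set.eq_univ_of_forall fun g => ?_).symm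
    obtain ⟨n, hn⟩ := Set.mem_iUnion.1
      ((iUnion_compactCovering H3).symm ▸ Set.mem_univ (g • axis 0))
    exact Set.mem_iUnion.2 ⟨n, g • axis 0, ⟨_, rfl, rfl⟩, hn⟩
  rw [← Set.countable_univ_iff, hu]
  exact Set.countable_iUnion fun n =>
    (h.finite_disjoint_inter_image isCompact_singleton (isCompact_compactCovering H3 n)).countable

lemma proj_smul (g : Γ) (p : H3) : proj Γ (g • p) = proj Γ p :=
  Quotient.sound ⟨g, rfl⟩

/-- The projection is open, so the interiors of a compact exhaustion project to an increasing open
cover of the compact quotient, and one member suffices. -/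
lemma exists_compact_cover (hΓ : Γ ≤ isomGroup) (hc : CompactSpace (Quot3 Γ)) :
    ∃ K : Set H3, IsCompact K ∧ ∀ p, ∃ g : Γ, g • p ∈ K := by
  have := continuousConstSMul_of_le hΓ
  let E := CompactExhaustion.choice H3
  have hopen : IsOpenMap (proj Γ) := isOpenMap_quotient_mk'_mul
  obtain ⟨n, hn⟩ := (isCompact_univ (X := Quot3 Γ)).elim_directed_cover
    (fun n => proj Γ '' interior (E n)) (fun n => hopen _ isOpen_interior)
    (fun x _ => by
      obtain ⟨p, rfl⟩ := Quotient.exists_rep x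
      obtain ⟨n, hn⟩ := E.exists_mem p
      exact Set.mem_iUnion.2 ⟨n + 1, p, E.subset_interior_succ n hn, rfl⟩)
    (Monotone.directed_le fun m n h => Set.image_mono (interior_mono (E.subset h)))
  refine ⟨E n, E.isCompact n, fun p => ?_⟩
  obtain ⟨q, hq, hqp⟩ := hn (Set.mem_univ (proj Γ p))
  obtain ⟨g, hg⟩ : q ∈ MulAction.orbit Γ p := Quotient.exact hqp
  exact ⟨g, by rw [show g • p = q from hg]; exact interior_subset hq⟩

lemma hvol_lt_top_of_isCompact {K : Set H3} (hK : IsCompact K) : hvol K < ⊤ := by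
  rw [hvol_eq_setLIntegral hK.measurableSet]
  have hK' : IsCompact (Subtype.val '' K : Set (ℂ × ℝ)) := hK.image continuous_subtype_val
  have hi : IntegrableOn (fun q : ℂ × ℝ => 1 / q.2 ^ 3) (Subtype.val '' K) := by
    refine ContinuousOn.integrableOn_compact hK' (continuousOn_const.div (by fun_prop) ?_)
    rintro _ ⟨p, -, rfl⟩
    exact (pow_pos p.2 3).ne'
  exact hi.lintegral_lt_top

/-- Translates of a compact `K` cover `D`, and their traces on `D` have total volume `hvol K`. -/
lemma hvol_fundamentalDomain_lt_top (hΓ : IsClosedHyperbolic Γ) {D : Set H3}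
    (hD : IsFundamentalDomain Γ D hvol) : hvol D < ⊤ := by
  have hle := hΓ.le_isomGroup
  have := measurableConstSMul_of_le hle
  have := smulInvariantMeasure_of_le hle
  have := countable_of_properlyDiscontinuous hΓ.properlyDiscontinuous
  obtain ⟨K, hK, hcov⟩ := exists_compact_cover hle hΓ.compact
  have hsub : D ⊆ ⋃ g : Γ, g • K ∩ D := fun p hp => by
    obtain ⟨g, hg⟩ := hcov p
    exact Set.mem_iUnion.2 ⟨g⁻¹, Set.mem_smul_set_iff_inv_smul_mem.2 (by simpa using hg), hp⟩
  calc hvol D ≤ ∑' g : Γ, hvol (g • K ∩ D) := (measure_mono hsub).trans (measure_iUnion_le _)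
    _ = hvol K := (hD.measure_eq_tsum K).symm
    _ < ⊤ := hvol_lt_top_of_isCompact hK

lemma continuous_normSqAt {α : ℂ × ℝ → (ℂ × ℝ →L[ℝ] ℝ)} (hα : ContinuousOn α upper) :
    Continuous (normSqAt α) := by
  have : Continuous fun p : H3 => α p.1 := continuousOn_iff_continuous_domRestrict.1 hα
  have h (v : ℂ × ℝ) : Continuous fun p : H3 => α p.1 v := this.clm_apply continuous_const
  have ht : Continuous fun p : H3 => p.1.2 := by fun_prop
  exact (((ht.mul (h _)).pow 2).add ((ht.mul (h _)).pow 2)).add ((ht.mul (h _)).pow 2)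

lemma exists_normSqAt_le (hΓ : IsClosedHyperbolic Γ) {α : ℂ × ℝ → (ℂ × ℝ →L[ℝ] ℝ)}
    (hα : IsOneForm Γ α) : ∃ C, ∀ p, normSqAt α p ≤ C := by
  obtain ⟨K, hK, hcov⟩ := exists_compact_cover hΓ.le_isomGroup hΓ.compact
  obtain ⟨C, hC⟩ := hK.exists_bound_of_continuousOn
    (continuous_normSqAt hα.smooth.continuousOn).continuousOn
  refine ⟨C, fun p => ?_⟩
  obtain ⟨g, hg⟩ := hcov p
  rw [← normSqAt_invariant hΓ.le_isomGroup hα g.2 p]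
  exact (le_abs_self _).trans (hC _ hg)

/-- A set that injects into the quotient, with image in `W`, contributes at most the integral over
the part of a fundamental domain that lies over `W`. -/
lemma setLIntegral_le_fundamentalDomain (hΓ : IsClosedHyperbolic Γ) {D : Set H3}
    (hD : IsFundamentalDomain Γ D hvol) {F : H3 → ENNReal} (hF : ∀ (g : Γ) p, F (g • p) = F p)
    {T : Set H3} (hT : MeasurableSet T) (hinj : ∀ (g : Γ), ∀ p ∈ T, g • p ∈ T → g = 1)
    {W : Set (Quot3 Γ)} (hW : T ⊆ proj Γ ⁻¹' W) :
    ∫⁻ p in T, F p ∂hvol ≤ ∫⁻ p in D ∩ proj Γ ⁻¹' W, F p ∂hvol := by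
  have hle := hΓ.le_isomGroup
  have := measurableConstSMul_of_le hle
  have := smulInvariantMeasure_of_le hle
  have := countable_of_properlyDiscontinuous hΓ.properlyDiscontinuous
  have hm (g : Γ) : MeasurableSet (g • T) := hT.const_smul g
  have hdisj : Pairwise (Function.onFun Disjoint fun g : Γ => g • T) := by
    intro g h hgh
    refine Set.disjoint_left.2 ?_
    rintro _ ⟨p, hp, rfl⟩ hq
    rw [Set.mem_smul_set_iff_inv_smul_mem, smul_smul] at hq
    exact hgh (inv_mul_eq_one.1 (hinj _ p hp hq)).symm
  calc ∫⁻ p in T, F p ∂hvol = ∑' g : Γ, ∫⁻ p in g • T, F p ∂(hvol.restrict D) := by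
        rw [hD.setLIntegral_eq_tsum' F T]
        refine tsum_congr fun g => ?_
        rw [Measure.restrict_restrict (hm g)]
        simp only [hF]
    _ = ∫⁻ p in ⋃ g : Γ, g • T, F p ∂(hvol.restrict D) := (lintegral_iUnion hm hdisj _).symm
    _ ≤ ∫⁻ p in proj Γ ⁻¹' W, F p ∂(hvol.restrict D) := by
        refine lintegral_mono_set (Set.iUnion_subset fun g => ?_)
        rintro _ ⟨p, hp, rfl⟩
        have := hW hp
        rwa [Set.mem_preimage, ← proj_smul g] at this
    _ = ∫⁻ p in D ∩ proj Γ ⁻¹' W, F p ∂hvol := by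
        rw [Measure.restrict_restrict₀' hD.nullMeasurableSet, Set.inter_comm]

/-! ### Primitives and periods. -/

lemma exists_primitive {α : ℂ × ℝ → (ℂ × ℝ →L[ℝ] ℝ)} (hα : ContDiffOn ℝ (⊤ : ℕ∞) α upper)
    (hc : IsClosedForm α) : ∃ f : ℂ × ℝ → ℝ, ∀ q ∈ upper, HasFDerivAt f (α q) q :=
  convex_upper.exists_forall_hasFDerivAt_of_fderiv_symmetric isOpen_upper
    (hα.differentiableOn (by simp)) fun a ha x y => sub_eq_zero.1 (hc a ha x y)

section Pullback

variable {α : ℂ × ℝ → (ℂ × ℝ →L[ℝ] ℝ)} {f : ℂ × ℝ → ℝ} {ψ : Equiv.Perm H3}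

lemma hasFDerivAt_comp_extend (hψ : ψ ∈ isomGroup) (hf : ∀ q ∈ upper, HasFDerivAt f (α q) q) :
    ∀ q ∈ upper, HasFDerivAt (fun q => f (extend ψ q))
      ((α (extend ψ q)).comp (fderiv ℝ (extend ψ) q)) q := fun q hq =>
  (hf _ (extend_mem ψ hq)).comp q (isomGroup_hasFDerivAt hψ ⟨q, hq⟩)

lemma continuousOn_pullback (hψ : ψ ∈ isomGroup) (hα : ContinuousOn α upper) :
    ContinuousOn (fun q => (α (extend ψ q)).comp (fderiv ℝ (extend ψ) q)) upper := by
  have h1 := isomGroup_contDiffOn hψ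
  exact (hα.comp h1.continuousOn fun q hq => extend_mem ψ hq).clm_comp
    (h1.continuousOn_fderiv_of_isOpen isOpen_upper (by simp))

/-- A geodesic line is defined metrically; its differentiability comes from the smoothness of `ψ`.
-/
lemma coreIntegral_eq_sub (hψ : ψ ∈ isomGroup) {c : ℝ → H3} (hc : ∀ s, c s = ψ (axis s))
    (hα : ContinuousOn α upper) (hf : ∀ q ∈ upper, HasFDerivAt f (α q) q) (ε : ℝ) :
    coreIntegral c ε α = f (c ε).1 - f (c 0).1 := by
  have haxis (s : ℝ) : HasDerivAt (fun u : ℝ => ((0 : ℂ), Real.exp u)) (0, Real.exp s) s :=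
    (hasDerivAt_const s _).prodMk (Real.hasDerivAt_exp s)
  have hcv (s : ℝ) : (c s).1 = extend ψ (0, Real.exp s) := by
    rw [hc, ← extend_apply]; rfl
  have hcd (s : ℝ) : HasDerivAt (fun u => (c u).1)
      (fderiv ℝ (extend ψ) (0, Real.exp s) (0, Real.exp s)) s := by
    simp_rw [hcv]
    exact HasFDerivAt.comp_hasDerivAt (f := fun u : ℝ => ((0 : ℂ), Real.exp u)) s
      (isomGroup_hasFDerivAt hψ (axis s)) (haxis s)
  have hd (s : ℝ) : HasDerivAt (fun u => f (c u).1) (α (c s).1 (deriv (fun u => (c u).1) s)) s := by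
    have := HasFDerivAt.comp_hasDerivAt (f := fun u => (c u).1) s (hf _ (c s).2) (hcd s)
    rwa [(hcd s).deriv]
  rw [coreIntegral, intervalIntegral.integral_eq_sub_of_hasDerivAt (fun s _ => hd s)]
  refine Continuous.intervalIntegrable ?_ _ _
  have h1 : Continuous fun s : ℝ => ((0 : ℂ), Real.exp s) := by fun_prop
  have h2 := ((continuousOn_pullback hψ hα).comp_continuous h1 fun s => Real.exp_pos s).clm_apply h1
  refine h2.congr fun s => ?_
  rw [(hcd s).deriv, hcv]
  rfl

lemma primitive_apply_sub_eq (hψ : ψ ∈ isomGroup) (hf : ∀ q ∈ upper, HasFDerivAt f (α q) q)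
    (hinv : ∀ p : H3, (α (ψ p).1).comp (fderiv ℝ (extend ψ) p.1) = α p.1) (p q : H3) :
    f (ψ p).1 - f p.1 = f (ψ q).1 - f q.1 := by
  have hd (r : ℂ × ℝ) (hr : r ∈ upper) : HasFDerivAt (fun r => f (extend ψ r) - f r) (0 : ℂ × ℝ →L[ℝ] ℝ) r := by
    have h1 := hinv ⟨r, hr⟩
    rw [← extend_apply] at h1
    have h2 := (hasFDerivAt_comp_extend hψ hf r hr).sub (hf r hr)
    rwa [h1, sub_self] at h2
  have := isOpen_upper.is_const_of_fderiv_eq_zero (𝕜 := ℝ) (f := fun r => f (extend ψ r) - f r)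
    convex_upper.isPreconnected (fun r hr => (hd r hr).differentiableAt.differentiableWithinAt)
    (fun r hr => (hd r hr).fderiv) p.2 q.2
  simpa only [extend_apply] using this

end Pullback

/-! ### The cylinder inside the embedded tube. -/

lemma cylinder_image_subset_nbhd {ψ : Equiv.Perm H3} (hψ : ψ ∈ isomGroup) {c : ℝ → H3}
    (hc : ∀ s, c s = ψ (axis s)) {ε R : ℝ} (hR : 0 < R) :
    ψ '' cylinder ε (Real.sinh R) ⊆ nbhd c R := by
  rintro _ ⟨p, ⟨h1, -, -⟩, rfl⟩
  have hp := p.2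
  have hW := eucl_pos_of_mem hp
  -- The axis point nearest to `p` has height `|p|`, with `cosh d = |p| / t`; the bound `|x| < t
  -- sinh R` says `|p| < t cosh R`.
  refine ⟨Real.log √(eucl p.1), ?_⟩
  rw [hc, isomGroup_hdist hψ]
  set u := Real.log √(eucl p.1)
  have hu : Real.exp u = √(eucl p.1) := Real.exp_log (Real.sqrt_pos.2 hW)
  have h2 := cosh_hdist_axis p u
  rw [hu, Real.sq_sqrt hW.le] at h2
  have h3 : Real.cosh (hdist p (axis u)) * p.1.2 = √(eucl p.1) := by
    have hs := Real.sqrt_pos.2 hW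
    have hm := Real.mul_self_sqrt hW.le
    refine mul_right_cancel₀ hs.ne' ?_
    rw [hm]; linarith
  have h4 : √(eucl p.1) < Real.cosh R * p.1.2 := by
    rw [Real.sqrt_lt' (mul_pos (Real.cosh_pos R) hp), eucl, mul_pow, Real.cosh_sq]
    have := pow_lt_pow_left₀ h1 (norm_nonneg _) two_ne_zero
    linarith
  rw [← h3] at h4
  have h5 := Real.cosh_lt_cosh.1 (lt_of_mul_lt_mul_right h4 hp.le)
  rwa [abs_of_nonneg (hdist_nonneg _ _), abs_of_pos hR] at h5

lemma height_zpow {g : Equiv.Perm H3} {ε : ℝ} (h : ∀ p, (g p).1.2 = Real.exp ε * p.1.2) (n : ℤ)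
    (p : H3) : ((g ^ n) p).1.2 = Real.exp (n * ε) * p.1.2 := by
  have hinv (p : H3) : (g⁻¹ p).1.2 = Real.exp (-ε) * p.1.2 := by
    have := h (g⁻¹ p)
    rw [← Equiv.Perm.mul_apply, mul_inv_cancel, Equiv.Perm.one_apply] at this
    rw [this, ← mul_assoc, ← Real.exp_add]
    simp
  induction n generalizing p with
  | zero => simp
  | succ n ih =>
    rw [zpow_add_one, Equiv.Perm.mul_apply, ih, h, ← mul_assoc, ← Real.exp_add]
    push_cast
    ring_nf
  | pred n ih =>
    rw [zpow_sub_one, Equiv.Perm.mul_apply, ih, hinv, ← mul_assoc, ← Real.exp_add]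
    push_cast
    ring_nf

/-- Embeddedness gives `g • p = γ ^ n p`. Heights multiply by `e^(n ε)` yet both lie in the
half-open `[1, e^ε)`, so `n = 0`, and freeness concludes. -/
lemma eq_one_of_mem_cylinder_image {γ : Equiv.Perm H3} {c : ℝ → H3} {ε R : ℝ}
    (hΓ : IsClosedHyperbolic Γ) (hV : IsTube Γ γ c ε R) {ψ : Equiv.Perm H3} (hψ : ψ ∈ isomGroup)
    (hc : ∀ s, c s = ψ (axis s))
    (hheight : ∀ p, ((ψ⁻¹ * γ * ψ) p).1.2 = Real.exp ε * p.1.2) (g : Γ) (p : H3)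
    (hp : p ∈ ψ '' cylinder ε (Real.sinh R)) (hgp : g • p ∈ ψ '' cylinder ε (Real.sinh R)) :
    g = 1 := by
  have hsub := cylinder_image_subset_nbhd hψ hc hV.depth_pos (ε := ε)
  obtain ⟨n, hn⟩ := hV.embedded p (hsub hp) (g • p) (hsub hgp) (proj_smul g p).symm
  obtain ⟨a, ⟨-, ha1, ha2⟩, rfl⟩ := hp
  obtain ⟨b, ⟨-, hb1, hb2⟩, hb⟩ := hgp
  have hba : b = ((ψ⁻¹ * γ * ψ) ^ n) a := by
    have : (ψ⁻¹ * γ * ψ) ^ n = ψ⁻¹ * γ ^ n * ψ := by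
      simpa using (conj_zpow (a := ψ⁻¹) (b := γ) (i := n))
    rw [this, Equiv.Perm.mul_apply, Equiv.Perm.mul_apply, ← hn, ← hb]
    simp
  have hh := height_zpow hheight n a
  rw [← hba] at hh
  have hε := hV.length_pos
  have hlt : (n : ℝ) * ε < ε := by
    rw [← Real.exp_lt_exp]
    nlinarith [Real.exp_pos ((n : ℝ) * ε)]
  have hgt : -ε < (n : ℝ) * ε := by
    rw [← Real.exp_lt_exp, Real.exp_neg, inv_lt_iff_one_lt_mul₀ (Real.exp_pos ε), mul_comm]
    nlinarith [Real.exp_pos ((n : ℝ) * ε)]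
  have h1 : (n : ℝ) < 1 := by nlinarith
  have h2 : (-1 : ℝ) < n := by nlinarith
  have hn0 : n = 0 := by
    have h1 : n < 1 := by exact_mod_cast h1
    have h2 : -1 < n := by exact_mod_cast h2
    omega
  rw [hn0, zpow_zero] at hn
  exact Subtype.ext (hΓ.free g.1 g.2 _ hn)

end HypTube

/-! ### Assembly. -/

open HypTube MeasureTheory in
theorem lemma6p1 (Γ : Subgroup (Equiv.Perm HypTube.H3)) (hΓ : HypTube.IsClosedHyperbolic Γ)
    (D : Set HypTube.H3) (hD : MeasureTheory.IsFundamentalDomain Γ D HypTube.hvol)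
    (γ : Equiv.Perm HypTube.H3) (c : ℝ → HypTube.H3) (ε R : ℝ)
    (hV : HypTube.IsTube Γ γ c ε R)
    (α : ℂ × ℝ → (ℂ × ℝ →L[ℝ] ℝ)) (hα : HypTube.IsHarmonic Γ D α)
    (hC : HypTube.coreIntegral c ε α = 1) :
    Real.sqrt (2 * Real.pi / ε * Real.log (Real.cosh R)) ≤
      HypTube.l2NormOn Γ D (HypTube.tube Γ c R) α := by
  have hle := hΓ.le_isomGroup
  have hγ := hle hV.mem
  have hαc := hα.isOneForm.smooth.continuousOn
  obtain ⟨ψ, hψ, hc⟩ := hV.geodesic.exists_isom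
  obtain ⟨f, hf⟩ := exists_primitive hα.isOneForm.smooth hα.closed
  have hperiod (p : H3) : f (γ p).1 = f p.1 + 1 := by
    have h1 := primitive_apply_sub_eq hγ hf (hα.isOneForm.invariant γ hV.mem) p (c 0)
    rw [hV.translates, zero_add, ← coreIntegral_eq_sub hψ hc hαc hf, hC] at h1
    linarith
  obtain ⟨L, hL⟩ := exists_linearIsometry_of_axis
    (isomGroup.mul_mem (isomGroup.mul_mem (isomGroup.inv_mem hψ) hγ) hψ) (ε := ε) fun s => by
      rw [Equiv.Perm.mul_apply, Equiv.Perm.mul_apply, ← hc, hV.translates, hc]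
      simp
  have hlow := le_lintegral_cylinder hV.length_pos (Real.sinh_pos_iff.2 hV.depth_pos)
    (continuousOn_pullback hψ hαc) (hasFDerivAt_comp_extend hψ hf) (L := L) fun q hq => by
      have h1 := hL ⟨q, hq⟩
      rw [← h1, extend_apply, extend_of_pos ψ hq, ← hperiod]
      simp
  have hpt : ∫⁻ p in cylinder ε (Real.sinh R), ENNReal.ofReal (p.1.2 ^ 2 *
        ((α (extend ψ p.1)).comp (fderiv ℝ (extend ψ) p.1)) p.1 ^ 2 / eucl p.1) ∂hvol ≤
      ∫⁻ p in ψ '' cylinder ε (Real.sinh R), ENNReal.ofReal (normSqAt α p) ∂hvol := by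
    rw [← (isomGroup_measurePreserving hψ).setLIntegral_comp_emb
      (isomGroup_measurableEmbedding hψ)]
    refine lintegral_mono fun p => ENNReal.ofReal_le_ofReal ?_
    have hp := p.2
    have hq := (ψ p).2
    have hW := eucl_pos_of_mem hp
    -- The test vector is the image of the radial vector at `p`, whose length is known by
    -- conformality.
    have h1 := le_normSqAt α (ψ p) (fderiv ℝ (extend ψ) p.1 p.1)
    have h2 := eucl_fderiv hψ p p.1
    rw [div_le_iff₀ hW, extend_apply, ContinuousLinearMap.comp_apply]
    refine le_of_mul_le_mul_right ?_ (pow_pos hq 2)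
    calc _ = (ψ p).1.2 ^ 2 * α (ψ p).1 (fderiv ℝ (extend ψ) p.1 p.1) ^ 2 * p.1.2 ^ 2 := by ring
      _ ≤ normSqAt α (ψ p) * eucl (fderiv ℝ (extend ψ) p.1 p.1) * p.1.2 ^ 2 := by gcongr
      _ = _ := by rw [mul_assoc, h2]; ring
  have hT := setLIntegral_le_fundamentalDomain hΓ hD (F := fun p => ENNReal.ofReal (normSqAt α p))
    (fun g p => by
      rw [show g • p = g.1 p from rfl, normSqAt_invariant hle hα.isOneForm g.2])
    ((isomGroup_measurableEmbedding hψ).measurableSet_image.2 measurableSet_cylinder)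
    (eq_one_of_mem_cylinder_image hΓ hV hψ hc fun p => by rw [hL])
    (W := tube Γ c R)
    fun p hp => ⟨p, cylinder_image_subset_nbhd hψ hc hV.depth_pos hp, rfl⟩
  obtain ⟨C, hCle⟩ := exists_normSqAt_le hΓ hα.isOneForm
  -- Finiteness is essential: an infinite energy would become 0 under `toReal`.
  have hfin : ∫⁻ p in D ∩ proj Γ ⁻¹' tube Γ c R, ENNReal.ofReal (normSqAt α p) ∂hvol ≠ ⊤ := by
    refine ne_top_of_le_ne_top ?_ (lintegral_mono fun p => ENNReal.ofReal_le_ofReal (hCle p))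
    rw [setLIntegral_const]
    exact ENNReal.mul_ne_top ENNReal.ofReal_ne_top
      (ne_top_of_le_ne_top (hvol_fundamentalDomain_lt_top hΓ hD).ne
        (measure_mono Set.inter_subset_left))
  have hfinal := (ENNReal.ofReal_le_iff_le_toReal hfin).1 ((hlow.trans hpt).trans hT)
  refine Real.sqrt_le_sqrt ?_
  rw [integral_eq_lintegral_of_nonneg_ae (Filter.Eventually.of_forall fun p => normSqAt_nonneg α p)
    (continuous_normSqAt hαc).aestronglyMeasurable]
  refine le_trans (le_of_eq ?_) hfinal
  -- The factor 2 comes from `1 + sinh² R = cosh² R` inside the logarithm.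
  rw [add_comm 1, ← Real.cosh_sq, Real.log_pow]
  push_cast
  ring
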